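/- Let $T$ be a complete first-order theory in a language $L$, let $|T|=|L|+\aleph_0$, and let $\mathfrak C$ be a monster model of $T$, i.e. a $\mu$-saturated model for some cardinal $\mu>|T|^+$. Sequences of (possibly infinite) tuples $I_i$ ($i\in\iota$), indexed by infinite linear orders, are mutually indiscernible over a set $A$ if each $I_i$ is indiscernible over $A\cup\bigcup_{j\ne i}I_j$. A partial type $p(x)$ over $A$ in a finite tuple of variables $x$ has dp-rank $<\kappa$ if for every $a\models p$ and any $\kappa$ sequences in $\mathfrak C$ that are mutually indiscernible over $A$, at least one of them is indiscernible over $Aa$; $p$ is dependent if it has dp-rank $<\kappa$ for some (small, i.e. $<\mu$) cardinal $\kappa$. The theory $T$ is dependent if the type $\{x=x\}$, with $x$ a single variable, is dependent. Then $T$ is dependent if and only if the following holds: for every finite set $A\subseteq\mathfrak C$, every sequence $\langle a_i \mid i<|T|^+\rangle$ of elements of $\mathfrak C$ (singletons) that is indiscernible over $A$, and every element $c\in\mathfrak C$, there is $\alpha<|T|^+$ such that the end segment $\langle a_i\mid \alpha<i<|T|^+\rangle$ is indiscernible over $A\cup\{c\}$. -/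

import Mathlib

universe u v w

namespace DpRank

open FirstOrder Cardinal



/-- `|T|` for a theory `T` in the language `L`, i.e. the number of `L`-formulas, `|L| + ℵ₀`. -/
noncomputable def theoryCard (L : FirstOrder.Language.{u, v}) : Cardinal.{max u v} :=
  max ℵ₀ L.card

section

variable (L : FirstOrder.Language.{u, v}) {C : Type w} [L.Structure C]

/-- The tuple `a` realizes the set `p` of formulas with parameters in `A`. -/
def Realizes {A : Set C} {α : Type*} (p : Set (L[[A]].Formula α)) (a : α → C) : Prop :=
  ∀ φ ∈ p, φ.Realize a

variable (C) in
/-- `C` is `κ`-saturated: for every set `A` of fewer than `κ` parameters, every set of formulas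
over `A` in one variable that is finitely satisfiable in `C` is realized in `C`. -/
def IsSaturated (κ : Cardinal.{w}) : Prop :=
  ∀ A : Set C, #A < κ → ∀ p : Set (L[[A]].Formula (Fin 1)),
    (∀ q ⊆ p, q.Finite → ∃ b : Fin 1 → C, Realizes L q b) →
      ∃ b : Fin 1 → C, Realizes L p b

/-- The sequence `(I j)_{j ∈ J}` of `α`-tuples is indiscernible over `A`: any two increasing finite
subsequences of the same length satisfy the same formulas with parameters in `A`. -/
def Indiscernible (A : Set C) {J : Type*} [LinearOrder J] {α : Type*} (I : J → α → C) : Prop :=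
  ∀ (n : ℕ) (φ : L[[A]].Formula (Fin n × α)) (s t : Fin n ↪o J),
    φ.Realize (fun k => I (s k.1) k.2) ↔ φ.Realize (fun k => I (t k.1) k.2)

/-- The set of all coordinates of all members of a sequence of tuples. -/
def seqSet {J : Type*} {α : Type*} (I : J → α → C) : Set C :=
  {c | ∃ j k, I j k = c}

/-- The sequences `I i` (each with its own index order and its own length of tuples) are mutually
indiscernible over `A`: each is indiscernible over `A` together with all the other sequences. -/
def MutuallyIndiscernible (A : Set C) {ι : Type*} {J : ι → Type*} [∀ i, LinearOrder (J i)]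
    {α : ι → Type*} (I : ∀ i, J i → α i → C) : Prop :=
  ∀ i, Indiscernible L (A ∪ ⋃ j ∈ {j | j ≠ i}, seqSet (I j)) (I i)

/-- `dp-rk(p) < κ` for a partial type `p` over `A`: for every realization `a` of `p` and all `κ`
(infinite) sequences which are mutually indiscernible over `A`, at least one of the sequences is
indiscernible over `Aa`. -/
def DpRankLT {A : Set C} {m : ℕ} (p : Set (L[[A]].Formula (Fin m))) (κ : Cardinal.{w}) : Prop :=
  ∀ a : Fin m → C, Realizes L p a →
    ∀ (ι : Type w), #ι = κ →
      ∀ (J : ι → Type w) [∀ i, LinearOrder (J i)] [∀ i, Infinite (J i)] (α : ι → Type w)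
        (I : ∀ i, J i → α i → C), MutuallyIndiscernible L A I →
          ∃ i, Indiscernible L (A ∪ Set.range a) (I i)

/-- The partial type `p` is dependent, i.e. `dp-rk(p) < ∞`. As always in a monster model, the
cardinals considered are the small ones, those below the degree of saturation `μ`. -/
def DependentType (μ : Cardinal.{w}) {A : Set C} {m : ℕ} (p : Set (L[[A]].Formula (Fin m))) :
    Prop :=
  ∃ κ < μ, DpRankLT L p κ

end

/-- A monster model of `T`: a model which is `μ`-saturated for some cardinal `μ > |T|⁺`.
(Cardinals below `μ` are called small.) -/
structure MonsterModel {L : FirstOrder.Language.{u, v}} (T : L.Theory) (C : Type w) [L.Structure C]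
    (μ : Cardinal.{w}) : Prop where
  nonempty : Nonempty C
  model : C ⊨ T
  large : Cardinal.lift.{w} (Order.succ (theoryCard L)) < Cardinal.lift.{max u v} μ
  saturated : IsSaturated L C μ

/-- The type `{x = x}` over `∅`, with `x` a single variable. -/
def trivialType (L : FirstOrder.Language.{u, v}) (C : Type w) :
    Set (L[[(∅ : Set C)]].Formula (Fin 1)) :=
  {(FirstOrder.Language.Term.var 0).equal (FirstOrder.Language.Term.var 0)}

/-- `T` is dependent, computed in a monster model `C` of `T`: the type `{x = x}` is dependent. -/
def DependentTheory {L : FirstOrder.Language.{u, v}} {T : L.Theory} {C : Type w} [L.Structure C]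
    {μ : Cardinal.{w}} (_ : MonsterModel T C μ) : Prop :=
  DependentType L μ (trivialType L C)

/-- The index set `{i | i < |T|⁺}`. -/
abbrev SuccIndex (L : FirstOrder.Language.{u, v}) : Type (max u v) :=
  (Order.succ (theoryCard L)).ord.ToType

end DpRank

namespace DpRank

open FirstOrder Cardinal FirstOrder.Language

/-! ### Formulas with parameters and usable forms of indiscernibility -/

section Formulas

variable {L : FirstOrder.Language.{u, v}} {C : Type w} [L.Structure C]

/-! Both directions translate between failure of indiscernibility and the behaviour of one formula.
The tools are a pigeonhole on the at most `|T|` formulas (`exists_cofinal_fiber`) and an extraction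
principle (`IsSaturated.exists_indiscernible`): any condition finitely satisfied along all
increasing subsequences of a sequence is satisfied by an indiscernible sequence of any small length.

Dependence gives end segments. If no end segment of `a` is indiscernible over `A` and `c`, one
formula `χ` takes both truth values at `c` beyond every index, so it alternates at `c` along
consecutive blocks (`exists_alternating_blocks`). For any small `κ`, extract an indiscernible
sequence indexed by `κ ×ₗ ℕ` and an `x` at which `χ` is true in column 0 and false in column 1 of
each row. Rows of a lexicographic indiscernible sequence are mutually indiscernible
(`mutuallyIndiscernible_of_lex`), yet none is indiscernible over `x`, so the dp-rank is not below
`κ`.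

End segments give dependence. If the dp-rank is not below `|T|⁺`, mutual indiscernibility and the
pigeonhole yield a formula `χ(x, y)` with the independence property, `x` a single variable
(`exists_independent_of_not_dpRankLT`). Passing to the dual puts the long sequence on the side of
`x`, so it consists of singletons. Extraction gives an indiscernible sequence of length `|T|⁺` and a
finite tuple `y` such that `χ(a_j, y)` holds exactly on a cofinal set with cofinal complement.
Applying the hypothesis once per entry of `y` makes an end segment indiscernible over `y`, a
contradiction. -/

theorem exists_formula_of_constants {A : Set C} {β : Type*} (φ : L[[A]].Formula β) :
    ∃ ψ : L.Formula (A ⊕ β), ∀ v : β → C,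
      φ.Realize v ↔ ψ.Realize (Sum.elim (fun a : A => (a : C)) v) :=
  ⟨BoundedFormula.constantsVarsEquiv φ, fun v =>
    (BoundedFormula.realize_constantsVarsEquiv (φ := φ) (v := v) (xs := default)).symm⟩

theorem exists_constants_of_formula {A : Set C} {β γ : Type*} (ψ : L.Formula γ)
    (g : γ → A ⊕ β) :
    ∃ φ : L[[A]].Formula β, ∀ v : β → C,
      φ.Realize v ↔ ψ.Realize (fun x => Sum.elim (fun a : A => (a : C)) v (g x)) := by
  refine ⟨BoundedFormula.constantsVarsEquiv.symm (Formula.relabel g ψ), fun v => ?_⟩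
  have := BoundedFormula.realize_constantsVarsEquiv (M := C)
    (φ := BoundedFormula.constantsVarsEquiv.symm (Formula.relabel g ψ)) (v := v) (xs := default)
  rw [Equiv.apply_symm_apply] at this
  refine this.symm.trans ?_
  exact Formula.realize_relabel (φ := ψ) (g := g)

theorem exists_finite_support {β : Type*} (ψ : L.Formula β) :
    ∃ (m : ℕ) (χ : L.Formula (Fin m)) (f : Fin m → β), ∀ v : β → C,
      ψ.Realize v ↔ χ.Realize (v ∘ f) := by
  classical
  let e := ψ.freeVarFinset.equivFin
  refine ⟨_, BoundedFormula.restrictFreeVar ψ e, fun k => (e.symm k : β), fun v => ?_⟩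
  exact (BoundedFormula.realize_restrictFreeVar (φ := ψ) (f := e)
    (v := v ∘ fun k => (e.symm k : β)) (v' := v) (fun a => by simp)).symm

theorem exists_finite_support_of_constants {A : Set C} {β : Type*} (φ : L[[A]].Formula β) :
    ∃ (m : ℕ) (χ : L.Formula (Fin m)) (f : Fin m → A ⊕ β), ∀ v : β → C,
      φ.Realize v ↔ χ.Realize (fun x => Sum.elim (fun a : A => (a : C)) v (f x)) := by
  obtain ⟨ψ, hψ⟩ := exists_formula_of_constants φ
  obtain ⟨m, χ, f, h⟩ := exists_finite_support (C := C) ψ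
  exact ⟨m, χ, f, fun v => (hψ v).trans (h _)⟩

/-- Enumerate the common order pattern: the image of `f`, listed increasingly, supplies `s`, and the
matching values of `g` supply `t`. This allows positions that are repeated or unsorted. -/
theorem exists_orderEmb_factor {X J : Type*} [Finite X] [LinearOrder J] (f g : X → J)
    (h : ∀ x y, f x < f y ↔ g x < g y) :
    ∃ (n : ℕ) (r : X → Fin n) (s t : Fin n ↪o J), (∀ x, f x = s (r x)) ∧ ∀ x, g x = t (r x) := by
  classical
  have := Fintype.ofFinite X
  have heq : ∀ x y, f x = f y ↔ g x = g y := fun x y => by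
    rw [eq_iff_le_not_lt, eq_iff_le_not_lt, ← not_lt, ← not_lt, h, h]
  let F := Finset.univ.image f
  have hF : ∀ y : F, ∃ x, f x = y := fun y => by
    obtain ⟨x, -, hx⟩ := Finset.mem_image.1 y.2
    exact ⟨x, hx⟩
  choose p hp using hF
  let e := F.orderIsoOfFin rfl
  have hmem : ∀ x, f x ∈ F := fun x => Finset.mem_image_of_mem f (Finset.mem_univ x)
  refine ⟨F.card, fun x => e.symm ⟨f x, hmem x⟩, e.toOrderEmbedding.trans
    (OrderEmbedding.subtype _), OrderEmbedding.ofStrictMono (fun k => g (p (e k))) ?_, ?_, ?_⟩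
  · intro k l hkl
    rw [← h, hp, hp]
    exact e.strictMono hkl
  · intro x
    simp
  · intro x
    change g x = g (p (e (e.symm ⟨f x, hmem x⟩)))
    rw [← heq, hp, OrderIso.apply_symm_apply]

theorem Indiscernible.realize_iff {A : Set C} {J α X γ : Type*} [LinearOrder J] [Finite X]
    {I : J → α → C} (hI : Indiscernible L A I) (f g : X → J)
    (h : ∀ x y, f x < f y ↔ g x < g y) (ψ : L.Formula γ) (q : γ → A ⊕ X × α) :
    ψ.Realize (fun z => Sum.elim (fun a : A => (a : C)) (fun p => I (f p.1) p.2) (q z)) ↔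
      ψ.Realize (fun z => Sum.elim (fun a : A => (a : C)) (fun p => I (g p.1) p.2) (q z)) := by
  obtain ⟨n, r, s, t, hs, ht⟩ := exists_orderEmb_factor f g h
  obtain ⟨φ, hφ⟩ := exists_constants_of_formula (C := C) ψ (fun z => Sum.map id (Prod.map r id) (q z))
  have := hI n φ s t
  rw [hφ, hφ] at this
  convert this using 3 with z z
  · rcases q z with a | p <;> simp [hs]
  · rcases q z with a | p <;> simp [ht]

theorem Indiscernible.realize_iff_of_empty {J α X γ : Type*} [LinearOrder J] [Finite X]
    {I : J → α → C} (hI : Indiscernible L ∅ I) (f g : X → J)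
    (h : ∀ x y, f x < f y ↔ g x < g y) (ψ : L.Formula γ) (q : γ → X × α) :
    ψ.Realize (fun z => I (f (q z).1) (q z).2) ↔ ψ.Realize (fun z => I (g (q z).1) (q z).2) :=
  hI.realize_iff f g h ψ (fun z => Sum.inr (q z))

theorem indiscernible_empty_of_realize_iff {J α : Type*} [LinearOrder J] {I : J → α → C}
    (h : ∀ (n : ℕ) (φ : L.Formula (Fin n × α)) (s t : Fin n ↪o J),
      φ.Realize (fun k => I (s k.1) k.2) → φ.Realize (fun k => I (t k.1) k.2)) :
    Indiscernible L ∅ I := by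
  have key : ∀ (n : ℕ) (φ : L[[(∅ : Set C)]].Formula (Fin n × α)) (s t : Fin n ↪o J),
      φ.Realize (fun k => I (s k.1) k.2) → φ.Realize (fun k => I (t k.1) k.2) := by
    intro n φ s t hs
    obtain ⟨ψ, hψ⟩ := exists_formula_of_constants φ
    have e : ∀ v : Fin n × α → C, φ.Realize v ↔
        (Formula.relabel (Sum.elim (fun a : (∅ : Set C) => a.2.elim) id) ψ).Realize v := by
      intro v
      rw [hψ, Formula.realize_relabel]
      refine iff_of_eq (congrArg _ (funext fun z => ?_))
      rcases z with a | z
      · exact a.2.elim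
      · rfl
    rw [e] at hs ⊢
    exact h n _ s t hs
  exact fun n φ s t => ⟨key n φ s t, key n φ t s⟩

/-- Parameters from other rows lie entirely below or entirely above row `i`. Moving positions within
row `i` therefore preserves the order pattern of all positions together, and indiscernibility over
`∅` applies. -/
theorem mutuallyIndiscernible_of_lex {ι M N β β' : Type*} [LinearOrder ι] [LinearOrder M]
    [LinearOrder N] {b : ι ×ₗ M → β → C} (hb : Indiscernible L ∅ b) (g : N ↪o M) (h : β' → β) :
    MutuallyIndiscernible L (∅ : Set C)
      (fun (i : ι) (k : N) (z : β') => b (toLex (i, g k)) (h z)) := by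
  intro i
  change Indiscernible L (∅ ∪ ⋃ j ∈ {j | j ≠ i}, seqSet (fun (k : N) (z : β') => b (toLex (j, g k)) (h z)))
    (fun (k : N) (z : β') => b (toLex (i, g k)) (h z))
  set A : Set C := ∅ ∪ ⋃ j ∈ {j | j ≠ i}, seqSet (fun (k : N) (z : β') => b (toLex (j, g k)) (h z)) with hA
  intro n φ s t
  obtain ⟨m, χ, f, hχ⟩ := exists_finite_support_of_constants φ
  rw [hχ, hχ]
  have hr : ∀ a : A, ∃ (j : ι) (k : N) (z : β'), j ≠ i ∧ b (toLex (j, g k)) (h z) = a := by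
    rintro ⟨a, ha⟩
    simp only [hA, Set.empty_union, Set.mem_iUnion, Set.mem_ofPred_eq, seqSet] at ha
    obtain ⟨j, hj, k, z, hz⟩ := ha
    exact ⟨j, k, z, hj, hz⟩
  choose j k z hj hz using hr
  let F (s : Fin n ↪o N) (x : Fin m) : ι ×ₗ M :=
    Sum.elim (fun a => toLex (j a, g (k a))) (fun p => toLex (i, g (s p.1))) (f x)
  let q (x : Fin m) : Fin m × β := (x, Sum.elim (fun a => h (z a)) (fun p => h p.2) (f x))
  have e : ∀ s : Fin n ↪o N, (fun x => Sum.elim (fun a : A => (a : C))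
      (fun p => b (toLex (i, g (s p.1))) (h p.2)) (f x)) = fun x => b (F s (q x).1) (q x).2 := by
    intro s
    funext x
    simp only [F, q]
    rcases f x with a | p
    · simp [hz]
    · simp
  refine Iff.trans (iff_of_eq (congrArg _ (e s))) (Iff.trans ?_ (iff_of_eq (congrArg _ (e t))).symm)
  refine hb.realize_iff_of_empty (F s) (F t) (fun x y => ?_) χ q
  simp only [F]
  rcases f x with a | p <;> rcases f y with a' | p' <;>
    simp [Prod.Lex.toLex_lt_toLex, hj, fun a => (hj a).symm]

end Formulas

/-! ### From one-variable saturation to types in fewer than `μ` variables -/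

section Saturation

variable {L : FirstOrder.Language.{u, v}} {C : Type w} [L.Structure C]

/-- The partial assignment `v` on `S` satisfies every formula which is satisfied by almost all
assignments. -/
def PartiallyRealizes (L : FirstOrder.Language.{u, v}) {C : Type w} [L.Structure C] {Z : Type*}
    (U : Ultrafilter (Z → C)) (S : Set Z) (v : Z → C) : Prop :=
  ∀ ψ : L.Formula S,
    (∀ᶠ w in (U : Filter (Z → C)), ψ.Realize fun z => w z) → ψ.Realize fun z => v z

/-- The required value of `x` realizes a one-variable type over the image of `S`. A finite part of
it is satisfiable because its existential closure is a formula over `S` that holds for almost every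
`w`, witnessed by `w x`, and hence holds for `v`. -/
theorem PartiallyRealizes.exists_insert {μ : Cardinal.{w}} (hC : IsSaturated L C μ)
    {Z : Type*} (hZ : Cardinal.lift.{w} #Z < Cardinal.lift μ) {U : Ultrafilter (Z → C)}
    {S : Set Z} {v : Z → C} (h : PartiallyRealizes L U S v) {x : Z} (hx : x ∉ S) :
    ∃ v' : Z → C, Set.EqOn v v' S ∧ PartiallyRealizes L U (insert x S) v' := by
  classical
  have hA : #(v '' S) < μ := by
    rw [← Cardinal.lift_lt]
    exact (mk_image_le_lift.trans (Cardinal.lift_le.2 (mk_set_le S))).trans_lt hZ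
  have htr : ∀ φ : L.Formula ↥(insert x S), ∃ φ' : L[[v '' S]].Formula (Fin 1),
      ∀ b : Fin 1 → C, φ'.Realize b ↔ φ.Realize (fun z => Function.update v x (b 0) z) := by
    intro φ
    obtain ⟨φ', h'⟩ := exists_constants_of_formula (A := v '' S) (β := Fin 1) φ
      (fun z => if hz : (z : Z) ∈ S then Sum.inl ⟨v z, Set.mem_image_of_mem v hz⟩ else Sum.inr 0)
    refine ⟨φ', fun b => (h' b).trans (iff_of_eq (congrArg _ (funext fun z => ?_)))⟩
    by_cases hz : (z : Z) ∈ S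
    · have : (z : Z) ≠ x := fun e => hx (e ▸ hz)
      simp [hz, this]
    · have : (z : Z) = x := (Set.mem_insert_iff.1 z.2).resolve_right hz
      simp [this, hx]
  choose tr htr using htr
  obtain ⟨b, hb⟩ := hC (v '' S) hA
    (tr '' {φ | ∀ᶠ w in (U : Filter (Z → C)), φ.Realize fun z => w z}) (by
      intro q hq hqf
      obtain ⟨Q, hQ, hQf, rfl⟩ := Set.exists_subset_image_finite_and.1 ⟨q, hq, hqf, rfl⟩
      have : Finite Q := hQf
      have hi : ∀ w : Z → C, ((Formula.iInf (fun φ : Q => (φ : L.Formula ↥(insert x S)))).relabel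
          (fun z : ↥(insert x S) =>
            if hz : (z : Z) ∈ S then Sum.inl (⟨z, hz⟩ : S) else Sum.inr (0 : Fin 1)) |>.iExs (Fin 1)).Realize (fun z => w z) ↔
            ∃ c, ∀ φ ∈ Q, φ.Realize (fun z => Function.update w x c z) := by
        intro w
        have hv : ∀ i : Fin 1 → C, (Sum.elim (fun z : S => w z) i ∘ fun z : ↥(insert x S) =>
            if hz : (z : Z) ∈ S then Sum.inl (⟨z, hz⟩ : S) else Sum.inr (0 : Fin 1)) =
              fun z : ↥(insert x S) => Function.update w x (i 0) z := by
          intro i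
          funext z
          by_cases hz : (z : Z) ∈ S
          · have : (z : Z) ≠ x := fun e => hx (e ▸ hz)
            simp [hz, this]
          · have : (z : Z) = x := (Set.mem_insert_iff.1 z.2).resolve_right hz
            simp [this, hx]
        simp only [Formula.realize_iExs, Formula.realize_relabel, hv, Formula.realize_iInf,
          Subtype.forall]
        exact ⟨fun ⟨i, hi⟩ => ⟨i 0, hi⟩, fun ⟨c, hc⟩ => ⟨fun _ => c, hc⟩⟩
      obtain ⟨c, hc⟩ := (hi v).1 (h _ (by
        have : ∀ᶠ w in (U : Filter (Z → C)), ∀ φ ∈ Q, φ.Realize fun z => w z :=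
          (Set.Finite.eventually_all hQf).2 fun φ hφ => hQ hφ
        filter_upwards [this] with w hw
        rw [hi]
        exact ⟨w x, by simpa using hw⟩))
      refine ⟨fun _ => c, ?_⟩
      rintro _ ⟨φ, hφ, rfl⟩
      exact (htr φ _).2 (hc φ hφ))
  refine ⟨Function.update v x (b 0), fun z hz => ?_, fun ψ hψ => ?_⟩
  · have : z ≠ x := fun e => hx (e ▸ hz)
    simp [this]
  · exact (htr ψ b).1 (hb _ ⟨ψ, hψ, rfl⟩)

/-- The union of the chain works because a formula has finitely many free variables, all lying in
the domain of one member. -/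
theorem PartiallyRealizes.exists_of_isChain [Nonempty C] {Z : Type*} {U : Ultrafilter (Z → C)}
    (c : Set {p : Set Z × (Z → C) // PartiallyRealizes L U p.1 p.2})
    (hc : IsChain (fun p q => p.1.1 ⊆ q.1.1 ∧ Set.EqOn p.1.2 q.1.2 p.1.1) c) :
    ∃ q : {p : Set Z × (Z → C) // PartiallyRealizes L U p.1 p.2},
      ∀ p ∈ c, p.1.1 ⊆ q.1.1 ∧ Set.EqOn p.1.2 q.1.2 p.1.1 := by
  classical
  rcases c.eq_empty_or_nonempty with rfl | hne
  · refine ⟨⟨(∅, fun _ => Classical.arbitrary C), fun ψ hψ => ?_⟩, by simp⟩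
    obtain ⟨w, hw⟩ := hψ.exists
    refine (iff_of_eq (congrArg ψ.Realize (funext fun z => ?_))).1 hw
    exact z.2.elim
  let v : Z → C := fun z => if h : ∃ p ∈ c, z ∈ p.1.1 then h.choose.1.2 z else Classical.arbitrary C
  have hv : ∀ p ∈ c, Set.EqOn p.1.2 v p.1.1 := by
    intro p hp z hz
    have h : ∃ p ∈ c, z ∈ p.1.1 := ⟨p, hp, hz⟩
    simp only [v, dif_pos h]
    obtain ⟨h1, h2⟩ := h.choose_spec
    by_cases he : p = h.choose
    · rw [← he]
    · rcases hc hp h1 he with h3 | h3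
      · exact h3.2 hz
      · exact (h3.2 h2).symm
  refine ⟨⟨(⋃ p ∈ c, p.1.1, v), fun ψ hψ => ?_⟩, fun p hp =>
    ⟨Set.subset_biUnion_of_mem (u := fun p => p.1.1) hp, hv p hp⟩⟩
  obtain ⟨m, χ, f, hχ⟩ := exists_finite_support (C := C) ψ
  obtain ⟨p, hp, hsub⟩ := DirectedOn.exists_mem_subset_of_finset_subset_biUnion
    (f := fun p : {p : Set Z × (Z → C) // PartiallyRealizes L U p.1 p.2} => p.1.1) hne
    (fun p hp q hq => by
      by_cases he : p = q
      · exact ⟨p, hp, subset_rfl, he ▸ subset_rfl⟩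
      · rcases hc hp hq he with h | h
        · exact ⟨q, hq, h.1, subset_rfl⟩
        · exact ⟨p, hp, subset_rfl, h.1⟩)
    (s := Finset.univ.image fun k => (f k : Z)) (by
      intro z hz
      obtain ⟨k, -, rfl⟩ := Finset.mem_image.1 (Finset.mem_coe.1 hz)
      exact (f k).2)
  have hmem : ∀ k, (f k : Z) ∈ p.1.1 := fun k =>
    hsub (Finset.mem_coe.2 (Finset.mem_image_of_mem _ (Finset.mem_univ k)))
  have := p.2 (χ.relabel fun k => ⟨f k, hmem k⟩) (by
    filter_upwards [hψ] with w hw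
    rw [Formula.realize_relabel]
    exact (hχ _).1 hw)
  rw [Formula.realize_relabel] at this
  rw [hχ]
  exact (iff_of_eq (congrArg χ.Realize (funext fun k => hv p hp (hmem k)))).1 this

/-- Every set of formulas in fewer than `μ` variables which is finitely satisfiable in a
`μ`-saturated structure is realized. -/
theorem IsSaturated.realizes {μ : Cardinal.{w}} (hC : IsSaturated L C μ) [Nonempty C]
    {Z : Type*} (hZ : Cardinal.lift.{w} #Z < Cardinal.lift μ) (P : Set (L.Formula Z))
    (hP : ∀ Q ⊆ P, Q.Finite → ∃ v : Z → C, ∀ φ ∈ Q, φ.Realize v) :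
    ∃ v : Z → C, ∀ φ ∈ P, φ.Realize v := by
  let G : Set (Set (Z → C)) := (fun φ : L.Formula Z => {v | φ.Realize v}) '' P
  have hG : (Filter.generate G).NeBot := by
    rw [Filter.generate_neBot_iff]
    intro t ht htf
    obtain ⟨Q, hQP, hQf, rfl⟩ := Set.exists_subset_image_finite_and.1 ⟨t, ht, htf, rfl⟩
    obtain ⟨v, hv⟩ := hP Q hQP hQf
    refine ⟨v, ?_⟩
    rintro _ ⟨φ, hφ, rfl⟩
    exact hv φ hφ
  -- The ultrafilter chooses a complete type extending `P`; a maximal partial realization of it must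
  -- be total.
  let U := Ultrafilter.of (Filter.generate G)
  have hU : ∀ φ ∈ P, ∀ᶠ w in (U : Filter (Z → C)), φ.Realize w := fun φ hφ =>
    Ultrafilter.of_le _ (Filter.mem_generate_of_mem ⟨φ, hφ, rfl⟩)
  obtain ⟨m, hm⟩ := exists_maximal_of_chains_bounded
    (PartiallyRealizes.exists_of_isChain (L := L) (U := U))
    (fun h1 h2 => ⟨h1.1.trans h2.1, fun z hz => (h1.2 hz).trans (h2.2 (h1.1 hz))⟩)
  have huniv : ∀ x, x ∈ m.1.1 := by
    intro x
    by_contra hx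
    obtain ⟨v', h1, h2⟩ := m.2.exists_insert hC hZ hx
    exact hx ((hm ⟨(insert x m.1.1, v'), h2⟩ ⟨Set.subset_insert _ _, h1⟩).1 (Set.mem_insert _ _))
  refine ⟨m.1.2, fun φ hφ => ?_⟩
  have := m.2 (φ.relabel fun z => ⟨z, huniv z⟩) (by
    filter_upwards [hU φ hφ] with w hw
    rw [Formula.realize_relabel]
    exact hw)
  rw [Formula.realize_relabel] at this
  exact this

end Saturation

/-! ### Powers of a nonprincipal ultrafilter, in place of Ramsey's theorem -/

section IteratedUltrafilter

/-- The iterated product of a fixed nonprincipal ultrafilter on `ℕ`. -/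
noncomputable def iteratedUltrafilter : ∀ n : ℕ, Ultrafilter (Fin n → ℕ)
  | 0 => pure Fin.elim0
  | n + 1 => (Filter.hyperfilter ℕ).bind fun k => (iteratedUltrafilter n).map (Fin.cons k)

theorem eventually_iteratedUltrafilter_succ {n : ℕ} {p : (Fin (n + 1) → ℕ) → Prop} :
    (∀ᶠ v in (iteratedUltrafilter (n + 1) : Filter (Fin (n + 1) → ℕ)), p v) ↔
      ∀ᶠ k in (Filter.hyperfilter ℕ : Filter ℕ),
        ∀ᶠ v in (iteratedUltrafilter n : Filter (Fin n → ℕ)), p (Fin.cons k v) :=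
  Iff.rfl

/-- Projecting the `n`-th power to an increasing choice of `m` coordinates gives the `m`-th power.
The induction peels off the first coordinate, which `s` either uses as its own first value or omits.
-/
theorem eventually_iteratedUltrafilter_comp : ∀ {n m : ℕ} (s : Fin m → Fin n), StrictMono s →
    ∀ p : (Fin m → ℕ) → Prop,
      (∀ᶠ v in (iteratedUltrafilter n : Filter (Fin n → ℕ)), p (v ∘ s)) ↔
        ∀ᶠ v in (iteratedUltrafilter m : Filter (Fin m → ℕ)), p v := by
  intro n
  induction n with
  | zero =>
    intro m s hs p
    obtain rfl : m = 0 := by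
      rcases m with - | m
      · rfl
      · exact (s 0).elim0
    refine Filter.eventually_congr (Filter.Eventually.of_forall fun v => ?_)
    rw [Subsingleton.elim (v ∘ s) v]
  | succ n ih =>
    intro m s hs p
    rcases m with - | m
    · have h1 : ∀ v : Fin 0 → ℕ, p v ↔ p Fin.elim0 := fun v => by
        rw [Subsingleton.elim v Fin.elim0]
      simp only [h1, Filter.eventually_const]
    · have hpos : ∀ i : Fin m, 0 < s i.succ := fun i =>
        (Fin.zero_le _).trans_lt (hs (Fin.succ_pos i))
      rw [eventually_iteratedUltrafilter_succ]
      by_cases h0 : s 0 = 0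
      · rw [eventually_iteratedUltrafilter_succ]
        refine Filter.eventually_congr (Filter.Eventually.of_forall fun k => ?_)
        rw [← ih (fun i => (s i.succ).pred (hpos i).ne') (fun i j hij => by
          simpa using hs (Fin.succ_lt_succ_iff.2 hij)) (fun v => p (Fin.cons k v))]
        refine Filter.eventually_congr (Filter.Eventually.of_forall fun v => ?_)
        refine iff_of_eq (congrArg p (funext fun i => ?_))
        refine Fin.cases ?_ (fun i => ?_) i
        · simp [h0]
        · obtain ⟨j, hj⟩ := Fin.exists_succ_eq.2 (hpos i).ne'
          simp [← hj]
      · have hne : ∀ i, s i ≠ 0 := fun i => by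
          refine Fin.cases h0 (fun i => (hpos i).ne') i
        rw [← ih (fun i => (s i).pred (hne i)) (fun i j hij => by simpa using hs hij) p]
        have : ∀ (k : ℕ) (v : Fin n → ℕ), (Fin.cons k v : Fin (n + 1) → ℕ) ∘ s =
            v ∘ fun i => (s i).pred (hne i) := by
          intro k v
          funext i
          obtain ⟨j, hj⟩ := Fin.exists_succ_eq.2 (hne i)
          simp [← hj]
        simp only [this, Filter.eventually_const]

/-- By projection to pairs it suffices that almost every `l` exceeds a given `k`, which holds since
the ultrafilter is nonprincipal. -/
theorem eventually_iteratedUltrafilter_strictMono (n : ℕ) :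
    ∀ᶠ v in (iteratedUltrafilter n : Filter (Fin n → ℕ)), StrictMono v := by
  have h2 : ∀ᶠ v in (iteratedUltrafilter 2 : Filter (Fin 2 → ℕ)), v 0 < v 1 := by
    rw [eventually_iteratedUltrafilter_succ]
    refine Filter.Eventually.of_forall fun k => ?_
    rw [eventually_iteratedUltrafilter_succ]
    have : ∀ᶠ l in (Filter.hyperfilter ℕ : Filter ℕ), k < l :=
      Nat.hyperfilter_le_atTop (Filter.eventually_gt_atTop k)
    filter_upwards [this] with l hl
    exact Filter.Eventually.of_forall fun v => by simpa using hl
  have : ∀ᶠ v in (iteratedUltrafilter n : Filter (Fin n → ℕ)), ∀ i j : Fin n, i < j → v i < v j := by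
    simp only [Filter.eventually_all]
    intro i j hij
    have hs : StrictMono ![i, j] := by
      intro a b hab
      fin_cases a <;> fin_cases b <;> simp_all
    exact (eventually_iteratedUltrafilter_comp ![i, j] hs fun v => v 0 < v 1).2 h2
  filter_upwards [this] with v hv i j hij using hv i j hij

end IteratedUltrafilter

/-! ### Extraction of indiscernible sequences -/

section Extraction

variable {L : FirstOrder.Language.{u, v}} {C : Type w} [L.Structure C]

/-- By the ultrafilter dichotomy `ψ` is either almost surely true or almost surely false on
increasing tuples from `b`. The positions `s` and `t` see the same measure, so either the conclusion
or the negated premise holds almost surely. -/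
theorem eventually_realize_imp {β γ J : Type*} [LinearOrder J] (b : ℕ → β → C) {n : ℕ}
    (ψ : L.Formula (Fin n × β)) (s t : Fin n ↪o J) :
    ∃ F : Finset J, ∀ (N : ℕ) (e : Fin N ↪o J), (F : Set J) ⊆ Set.range e →
      ∀ᶠ v in (iteratedUltrafilter N : Filter (Fin N → ℕ)), ∀ k : J → ℕ, k ∘ e = v →
        ∀ c : γ → C,
          Formula.Realize ((ψ.relabel fun z => (Sum.inr (s z.1, z.2) : γ ⊕ J × β)).imp
            (ψ.relabel fun z => Sum.inr (t z.1, z.2)))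
            (Sum.elim c fun p => b (k p.1) p.2) := by
  classical
  refine ⟨Finset.univ.image s ∪ Finset.univ.image t, fun N e hF => ?_⟩
  have hs : ∀ i, ∃ x, e x = s i := fun i => hF (by simp)
  have ht : ∀ i, ∃ x, e x = t i := fun i => hF (by simp)
  choose s' hs using hs
  choose t' ht using ht
  have hs' : StrictMono s' := fun i j hij => by rw [← e.lt_iff_lt, hs, hs]; exact s.strictMono hij
  have ht' : StrictMono t' := fun i j hij => by rw [← e.lt_iff_lt, ht, ht]; exact t.strictMono hij
  simp only [Formula.realize_imp, Formula.realize_relabel]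
  rcases (iteratedUltrafilter n).eventually_or.1 (Filter.Eventually.of_forall fun v => em
    (ψ.Realize fun z => b (v z.1) z.2)) with h | h
  · filter_upwards [(eventually_iteratedUltrafilter_comp t' ht' _).2 h] with v hv k hk c _
    convert hv using 2
    simp [← hk, ht]
  · filter_upwards [(eventually_iteratedUltrafilter_comp s' hs' _).2 h] with v hv k hk c h1
    refine (hv ?_).elim
    convert h1 using 2
    simp [← hk, hs]

/-- Extraction of indiscernible sequences: if each finite part of `P` is satisfied by every
increasing finite subsequence of `b` together with some tuple, then `P` is satisfied by some
indiscernible sequence together with some tuple. -/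
theorem IsSaturated.exists_indiscernible {μ : Cardinal.{w}} (hC : IsSaturated L C μ) [Nonempty C]
    {β γ J : Type*} [LinearOrder J] (hZ : Cardinal.lift.{w} #(γ ⊕ J × β) < Cardinal.lift μ)
    (b : ℕ → β → C) (P : Set (L.Formula (γ ⊕ J × β)))
    (hP : ∀ Q ⊆ P, Q.Finite → ∃ F : Finset J, ∀ k : J → ℕ, StrictMonoOn k F →
      ∃ c : γ → C, ∀ φ ∈ Q, φ.Realize (Sum.elim c fun p => b (k p.1) p.2)) :
    ∃ (c : γ → C) (b' : J → β → C), Indiscernible L ∅ b' ∧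
      ∀ φ ∈ P, φ.Realize (Sum.elim c fun p => b' p.1 p.2) := by
  classical
  -- `R` is the scheme expressing indiscernibility over `∅`; it is realized together with `P`.
  let R : Set (L.Formula (γ ⊕ J × β)) := {φ | ∃ (n : ℕ) (ψ : L.Formula (Fin n × β))
    (s t : Fin n ↪o J), φ = (ψ.relabel fun z => (Sum.inr (s z.1, z.2) : γ ⊕ J × β)).imp
            (ψ.relabel fun z => Sum.inr (t z.1, z.2))}
  have hR : ∀ φ : R, ∃ F : Finset J, ∀ (N : ℕ) (e : Fin N ↪o J), (F : Set J) ⊆ Set.range e →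
      ∀ᶠ v in (iteratedUltrafilter N : Filter (Fin N → ℕ)), ∀ k : J → ℕ, k ∘ e = v →
        ∀ c : γ → C, Formula.Realize (φ : L.Formula (γ ⊕ J × β)) (Sum.elim c fun p => b (k p.1) p.2) := by
    rintro ⟨_, n, ψ, s, t, rfl⟩
    exact eventually_realize_imp b ψ s t
  choose F hF using hR
  obtain ⟨w, hw⟩ := hC.realizes hZ (P ∪ R) (by
    intro Q hQ hQf
    obtain ⟨F₀, hF₀⟩ := hP (Q ∩ P) Set.inter_subset_right (hQf.subset Set.inter_subset_left)
    have hfin : {φ : R | (φ : L.Formula _) ∈ Q}.Finite :=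
      hQf.preimage Subtype.val_injective.injOn
    let G := F₀ ∪ hfin.toFinset.biUnion F
    let e := G.orderEmbOfFin rfl
    have he : Set.range e = G := G.range_orderEmbOfFin rfl
    have hall : ∀ᶠ v in (iteratedUltrafilter G.card : Filter (Fin G.card → ℕ)),
        ∀ φ ∈ {φ : R | (φ : L.Formula _) ∈ Q}, ∀ k : J → ℕ, k ∘ e = v →
        ∀ c : γ → C, Formula.Realize (φ : L.Formula (γ ⊕ J × β)) (Sum.elim c fun p => b (k p.1) p.2) := by
      refine (Set.Finite.eventually_all hfin).2 fun φ hφ => hF φ _ e ?_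
      rw [he, Finset.coe_subset]
      exact (Finset.subset_biUnion_of_mem F (hfin.mem_toFinset.2 hφ)).trans
        Finset.subset_union_right
    obtain ⟨v, hv, hmono⟩ :=
      (hall.and (eventually_iteratedUltrafilter_strictMono G.card)).exists
    -- The default value `0` off `G` is harmless: the conditions on `k` concern only positions in
    -- `G`.
    let k : J → ℕ := Function.extend e v 0
    have hk : k ∘ e = v := Function.extend_comp e.injective v 0
    have hkm : StrictMonoOn k G := by
      rw [← he]
      rintro _ ⟨x, rfl⟩ _ ⟨y, rfl⟩ hxy
      have hx : k (e x) = v x := congrFun hk x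
      have hy : k (e y) = v y := congrFun hk y
      rw [hx, hy]
      exact hmono (e.lt_iff_lt.1 hxy)
    obtain ⟨c, hc⟩ := hF₀ k (hkm.mono (Finset.coe_subset.2 Finset.subset_union_left))
    refine ⟨Sum.elim c fun p => b (k p.1) p.2, fun φ hφ => ?_⟩
    rcases hQ hφ with h | h
    · exact hc φ ⟨hφ, h⟩
    · exact hv ⟨φ, h⟩ hφ k hk c)
  refine ⟨w ∘ Sum.inl, fun j z => w (Sum.inr (j, z)), ?_, fun φ hφ => ?_⟩
  · refine indiscernible_empty_of_realize_iff fun n ψ s t h => ?_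
    have := hw _ (Or.inr ⟨n, ψ, s, t, rfl⟩)
    rw [Formula.realize_imp, Formula.realize_relabel, Formula.realize_relabel] at this
    exact this h
  · convert hw φ (Or.inl hφ) using 2 with z
    funext z
    rcases z with z | z <;> rfl

end Extraction

/-! ### Counting formulas and cofinality in `|T|⁺` -/

section Cardinality

variable (L : FirstOrder.Language.{u, v})

theorem mk_formula_le_theoryCard (β : Type) [Countable β] : #(L.Formula β) ≤ theoryCard L := by
  have h1 : #(L.Formula β) ≤ #(Σ n, L.BoundedFormula β n) :=
    mk_le_of_injective (f := fun φ => ⟨0, φ⟩) fun φ ψ h => by simpa using h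
  refine h1.trans (BoundedFormula.card_le.trans ?_)
  have h2 : Cardinal.lift.{max u v} #β ≤ theoryCard L :=
    (Cardinal.lift_le_aleph0.2 mk_le_aleph0).trans (le_max_left _ _)
  refine max_le (le_max_left _ _) ?_
  rw [Cardinal.lift_id']
  exact add_le_of_le (le_max_left _ _) h2 (le_max_right _ _)

theorem mk_sigma_formula_le_theoryCard (β : ℕ → Type) [∀ n, Countable (β n)] :
    #(Σ n, L.Formula (β n)) ≤ theoryCard L := by
  rw [mk_sigma]
  refine (sum_le_sum _ (fun _ => theoryCard L) fun n => mk_formula_le_theoryCard L (β n)).trans ?_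
  rw [sum_const, mk_nat, lift_aleph0, Cardinal.lift_id']
  exact mul_le_of_le (le_max_left _ _) (le_max_left _ _) le_rfl

instance : Nonempty (SuccIndex L) :=
  mk_ne_zero_iff.1 (by rw [mk_ord_toType]; exact (Order.succ_ne_bot _))

theorem mk_Iic_succIndex_le (α : SuccIndex L) : #(Set.Iic α) ≤ theoryCard L := by
  rw [← Set.Iio_insert]
  refine mk_insert_le.trans (add_le_of_le (le_max_left _ _) ?_ ?_)
  · have := mk_Iio_lt α (by simp)
    rw [mk_ord_toType] at this
    exact Order.lt_succ_iff.1 this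
  · exact one_le_aleph0.trans (le_max_left _ _)

theorem exists_gt_of_mk_lt (S : Set (SuccIndex L)) (hS : theoryCard L < #S) (α : SuccIndex L) :
    ∃ β ∈ S, α < β := by
  by_contra! h
  exact hS.not_ge ((mk_le_mk_of_subset h).trans (mk_Iic_succIndex_le L α))

/-- Regularity of `|T|⁺`: if every fiber were bounded, at most `|T|` initial segments, each of size
at most `|T|`, would cover it. -/
theorem exists_cofinal_fiber {K : Type (max u v)} (hK : #K ≤ theoryCard L) (f : SuccIndex L → K) :
    ∃ k, ∀ α, ∃ β, α < β ∧ f β = k := by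
  by_contra! h
  choose g hg using h
  have huniv : (⋃ k, Set.Iic (g k)) = Set.univ := by
    refine Set.eq_univ_of_forall fun β => Set.mem_iUnion.2 ⟨f β, ?_⟩
    by_contra hβ
    exact hg _ β (not_le.1 hβ) rfl
  have h1 : #(⋃ k, Set.Iic (g k)) ≤ theoryCard L := by
    refine (mk_iUnion_le_sum_mk).trans ((sum_le_sum _ (fun _ => theoryCard L)
      fun k => mk_Iic_succIndex_le L (g k)).trans ?_)
    rw [sum_const, Cardinal.lift_id, Cardinal.lift_id]
    exact mul_le_of_le (le_max_left _ _) hK le_rfl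
  rw [huniv, mk_univ, mk_ord_toType] at h1
  exact (Order.lt_succ (theoryCard L)).not_ge h1

theorem exists_cofinal_compl_cofinal :
    ∃ S : Set (SuccIndex L), (∀ α, ∃ β ∈ S, α < β) ∧ ∀ α, ∃ β ∉ S, α < β := by
  have hinf : ℵ₀ ≤ #(SuccIndex L) := by
    rw [mk_ord_toType]
    exact (le_max_left _ _).trans (Order.le_succ _)
  have : #(SuccIndex L ⊕ SuccIndex L) = #(SuccIndex L) := by
    rw [mk_sum, Cardinal.lift_id, add_eq_self hinf]
  obtain ⟨e⟩ := Cardinal.eq.1 this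
  have hlt : theoryCard L < #(SuccIndex L) := by
    rw [mk_ord_toType]
    exact Order.lt_succ _
  have h1 : #(Set.range (e ∘ Sum.inl)) = #(SuccIndex L) :=
    mk_range_eq _ (e.injective.comp Sum.inl_injective)
  have h2 : #(Set.range (e ∘ Sum.inr)) = #(SuccIndex L) :=
    mk_range_eq _ (e.injective.comp Sum.inr_injective)
  refine ⟨Set.range (e ∘ Sum.inl), exists_gt_of_mk_lt L _ (h1 ▸ hlt), fun α => ?_⟩
  obtain ⟨_, ⟨β, rfl⟩, hβ⟩ := exists_gt_of_mk_lt L _ (h2 ▸ hlt) α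
  refine ⟨_, ?_, hβ⟩
  rintro ⟨γ, hγ⟩
  simpa using e.injective hγ

theorem MonsterModel.aleph0_lt {L : FirstOrder.Language.{u, v}} {T : L.Theory} {C : Type w}
    [L.Structure C] {μ : Cardinal.{w}} (hC : MonsterModel T C μ) : ℵ₀ < μ := by
  have h : ℵ₀ < Order.succ (theoryCard L) := (le_max_left _ _).trans_lt (Order.lt_succ _)
  have := (Cardinal.lift_lt.{max u v, w}.2 h).trans hC.large
  rw [lift_aleph0] at this
  exact aleph0_lt_lift.1 this

end Cardinality

/-! ### Alternation of one formula when no end segment is indiscernible -/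

section EndSegment

variable {L : FirstOrder.Language.{u, v}} {C : Type w} [L.Structure C]

/-- The parameters from `A` become free variables filled by `p`, so `χ` is an `L`-formula and the
pigeonhole applies. Exchanging `s` and `t` if necessary puts the true instance first. -/
theorem exists_formula_of_not_indiscernible {A : Set C} {N : ℕ} {p : Fin N → C}
    (hp : Set.range p = A) {c : C} {J : Type*} [LinearOrder J] {a : J → C}
    (h : ¬ Indiscernible L (insert c A) (fun i (_ : Unit) => a i)) :
    ∃ (n : ℕ) (χ : L.Formula (Unit ⊕ (Fin n ⊕ Fin N))) (s t : Fin n ↪o J),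
      χ.Realize (Sum.elim (fun _ => c) (Sum.elim (a ∘ s) p)) ∧
      ¬ χ.Realize (Sum.elim (fun _ => c) (Sum.elim (a ∘ t) p)) := by
  classical
  simp only [Indiscernible, not_forall] at h
  obtain ⟨n, φ, s, t, h⟩ := h
  obtain ⟨ψ, hψ⟩ := exists_formula_of_constants φ
  have hq : ∀ x : ↥(insert c A), ∃ z : Unit ⊕ Fin N, Sum.elim (fun _ => c) p z = x := by
    rintro ⟨x, rfl | hx⟩
    · exact ⟨Sum.inl (), rfl⟩
    · obtain ⟨k, rfl⟩ := hp.symm ▸ hx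
      exact ⟨Sum.inr k, rfl⟩
  choose q hq using hq
  let r : ↥(insert c A) ⊕ Fin n × Unit → Unit ⊕ (Fin n ⊕ Fin N) :=
    Sum.elim (fun x => Sum.map id Sum.inr (q x)) (fun z => Sum.inr (Sum.inl z.1))
  have hr : ∀ s : Fin n ↪o J, φ.Realize (fun k => a (s k.1)) ↔
      (ψ.relabel r).Realize (Sum.elim (fun _ => c) (Sum.elim (a ∘ s) p)) := by
    intro s
    rw [hψ, Formula.realize_relabel]
    refine iff_of_eq (congrArg _ (funext fun z => ?_))
    rcases z with x | z
    · have := hq x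
      simp only [Sum.elim_inl, Function.comp_apply, r]
      rcases h : q x with y | y <;> rw [h] at this <;> simpa using this.symm
    · simp [r]
  by_cases hs : φ.Realize (fun k => a (s k.1))
  · exact ⟨n, _, s, t, (hr s).1 hs, fun ht => h ((iff_of_true hs ((hr t).2 ht)))⟩
  · by_cases ht : φ.Realize (fun k => a (t k.1))
    · exact ⟨n, _, t, s, (hr t).1 ht, fun h => hs ((hr s).2 h)⟩
    · exact (h (iff_of_false hs ht)).elim

/-- If no end segment of `a` is indiscernible over `c` and the tuple `p`, then some formula
alternates at `c` along consecutive blocks of `a`. -/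
theorem exists_alternating_blocks {A : Set C} {N : ℕ} {p : Fin N → C}
    (hp : Set.range p = A) {c : C} {a : SuccIndex L → C}
    (h : ∀ α : SuccIndex L, ¬ Indiscernible L (insert c A)
      (fun (i : {i : SuccIndex L // α < i}) (_ : Unit) => a i)) :
    ∃ (n : ℕ) (χ : L.Formula (Unit ⊕ (Fin n ⊕ Fin N))) (S : ℕ → Fin n → SuccIndex L),
      (∀ k l i j, S k i < S l j ↔ k < l ∨ k = l ∧ i < j) ∧
      ∀ k, χ.Realize (Sum.elim (fun _ => c) (Sum.elim (a ∘ S k) p)) ↔ Even k := by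
  have h1 : ∀ α : SuccIndex L, ∃ (χ : Σ n, L.Formula (Unit ⊕ (Fin n ⊕ Fin N))),
      ∀ e : Prop, ∃ s : Fin χ.1 → SuccIndex L, StrictMono s ∧ (∀ i, α < s i) ∧
        (χ.2.Realize (Sum.elim (fun _ => c) (Sum.elim (a ∘ s) p)) ↔ e) := by
    intro α
    obtain ⟨n, χ, s, t, hs, ht⟩ := exists_formula_of_not_indiscernible hp (h α)
    refine ⟨⟨n, χ⟩, fun e => ?_⟩
    by_cases he : e
    · exact ⟨fun i => s i, fun i j hij => s.strictMono hij, fun i => (s i).2, iff_of_true hs he⟩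
    · exact ⟨fun i => t i, fun i j hij => t.strictMono hij, fun i => (t i).2, iff_of_false ht he⟩
  choose f hf using h1
  obtain ⟨⟨n, χ⟩, hχ⟩ := exists_cofinal_fiber L
    (mk_sigma_formula_le_theoryCard L fun n => Unit ⊕ (Fin n ⊕ Fin N)) f
  have h2 : ∀ (α : SuccIndex L) (e : Prop), ∃ s : Fin n → SuccIndex L,
      StrictMono s ∧ (∀ i, α < s i) ∧
        (χ.Realize (Sum.elim (fun _ => c) (Sum.elim (a ∘ s) p)) ↔ e) := by
    intro α e
    obtain ⟨β, hβ, hfβ⟩ := hχ α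
    have := hf β e
    rw [hfβ] at this
    obtain ⟨s, h1, h2, h3⟩ := this
    exact ⟨s, h1, fun i => hβ.trans (h2 i), h3⟩
  choose σ hσm hσl hσ using h2
  have h3 : ∀ (α : SuccIndex L) (e : Prop), ∃ β, α ≤ β ∧ ∀ i, σ α e i ≤ β := by
    intro α e
    obtain ⟨β, hβ⟩ := (Set.finite_range (σ α e)).bddAbove
    exact ⟨max α β, le_max_left _ _, fun i => (hβ ⟨i, rfl⟩).trans (le_max_right _ _)⟩
  choose B hB hBσ using h3
  -- `B' (k + 1)` bounds block `k`, and block `k + 1` is chosen strictly beyond it.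
  let B' (k : ℕ) : SuccIndex L :=
    Nat.rec (Classical.arbitrary _) (fun k α => B α (Even k)) k
  have hmono : Monotone B' := monotone_nat_of_le_succ fun k => hB _ _
  refine ⟨n, χ, fun k => σ (B' k) (Even k), ?_, fun k => hσ _ _⟩
  have key : ∀ k l i j, k < l → σ (B' k) (Even k) i < σ (B' l) (Even l) j := fun k l i j hkl =>
    (hBσ (B' k) (Even k) i).trans_lt ((hmono (Nat.succ_le_of_lt hkl)).trans_lt (hσl _ _ j))
  intro k l i j
  rcases lt_trichotomy k l with hkl | rfl | hkl
  · simp [hkl, key]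
  · simp [(hσm (B' k) (Even k)).lt_iff_lt]
  · simp [hkl.not_gt, hkl.ne', (key l k j i hkl).le]

end EndSegment

/-! ### Dependence implies indiscernible end segments -/

section Forward

variable {L : FirstOrder.Language.{u, v}} {C : Type w} [L.Structure C]

/-- The position of `(i, m)` when the rows in `T` are numbered consecutively. -/
noncomputable def rowPosition {ι : Type*} [LinearOrder ι] (T : Finset ι) (x : ι ×ₗ ℕ) : ℕ :=
  2 * (T.filter (· < (ofLex x).1)).card + (ofLex x).2

theorem strictMonoOn_rowPosition {ι : Type*} [LinearOrder ι] (T : Finset ι) :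
    StrictMonoOn (rowPosition T) {x | (ofLex x).1 ∈ T ∧ (ofLex x).2 < 2} := by
  rintro x ⟨hxT, hx⟩ y - hxy
  rcases (Prod.Lex.lt_iff).1 hxy with h | ⟨h1, h2⟩
  · have : (T.filter (· < (ofLex x).1)).card < (T.filter (· < (ofLex y).1)).card := by
      refine Finset.card_lt_card (Finset.ssubset_iff.2 ⟨(ofLex x).1, by simp, ?_⟩)
      refine Finset.insert_subset (by simp [hxT, h]) fun z hz => ?_
      simp only [Finset.mem_filter] at hz ⊢
      exact ⟨hz.1, hz.2.trans h⟩
    simp only [rowPosition]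
    omega
  · simp only [rowPosition, h1]
    omega

/-- The existence of `x` is a formula `Θ` about finitely many blocks over `A`. By indiscernibility
of `a` over `A` the blocks may be moved to positions where the rows of `T` occupy consecutive pairs
`2r`, `2r + 1`; there `c` is a witness, by alternation. -/
theorem exists_realize_rows {A : Set C} {N n : ℕ} {p : Fin N → C} (hp : Set.range p = A) {c : C}
    {J : Type*} [LinearOrder J] {a : J → C} (ha : Indiscernible L A (fun i (_ : Unit) => a i))
    {χ : L.Formula (Unit ⊕ (Fin n ⊕ Fin N))} {S : ℕ → Fin n → J}
    (hS : ∀ k l i j, S k i < S l j ↔ k < l ∨ k = l ∧ i < j)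
    (hχ : ∀ k, χ.Realize (Sum.elim (fun _ => c) (Sum.elim (a ∘ S k) p)) ↔ Even k)
    {ι : Type*} [LinearOrder ι] (T : Finset ι) {k : ι ×ₗ ℕ → ℕ}
    (hk : StrictMonoOn k {x | (ofLex x).1 ∈ T ∧ (ofLex x).2 < 2}) :
    ∃ x : C, ∀ i ∈ T,
      χ.Realize (Sum.elim (fun _ => x) (Sum.elim (a ∘ S (k (toLex (i, 0)))) p)) ∧
      ¬ χ.Realize (Sum.elim (fun _ => x) (Sum.elim (a ∘ S (k (toLex (i, 1)))) p)) := by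
  let Θ : L.Formula ((T × Fin 2) × (Fin n ⊕ Fin N)) :=
    (Formula.iInf fun i : T =>
      (χ.relabel (Sum.elim (fun _ => Sum.inr ()) (fun z => Sum.inl ((i, 0), z))) ⊓
      (χ.relabel (Sum.elim (fun _ => Sum.inr ()) (fun z => Sum.inl ((i, 1), z)))).not :
        L.Formula (((T × Fin 2) × (Fin n ⊕ Fin N)) ⊕ Unit))).iExs Unit
  have hΘ : ∀ v : (T × Fin 2) × (Fin n ⊕ Fin N) → C, Θ.Realize v ↔ ∃ x : C, ∀ i : T,
      χ.Realize (Sum.elim (fun _ => x) (fun z => v ((i, 0), z))) ∧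
      ¬ χ.Realize (Sum.elim (fun _ => x) (fun z => v ((i, 1), z))) := by
    intro v
    have hv : ∀ (i : T) (e : Fin 2) (x : Unit → C), (Sum.elim v x ∘ Sum.elim (fun _ : Unit => Sum.inr ())
        (fun z => Sum.inl ((i, e), z))) = Sum.elim (fun _ => x ()) (fun z => v ((i, e), z)) := by
      intro i e x
      funext z
      rcases z with z | z <;> rfl
    simp only [Θ, Formula.realize_iExs, Formula.realize_iInf, Formula.realize_inf,
      Formula.realize_not, Formula.realize_relabel, hv]
    exact ⟨fun ⟨x, hx⟩ => ⟨x (), hx⟩, fun ⟨x, hx⟩ => ⟨fun _ => x, hx⟩⟩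
  let pos (x : (T × Fin 2) × Fin n) : ι ×ₗ ℕ := toLex (x.1.1, x.1.2)
  have hpos : ∀ x, pos x ∈ {x : ι ×ₗ ℕ | (ofLex x).1 ∈ T ∧ (ofLex x).2 < 2} := fun x =>
    ⟨x.1.1.2, x.1.2.2⟩
  let f (k : ι ×ₗ ℕ → ℕ) (x : (T × Fin 2) × Fin n) : J := S (k (pos x)) x.2
  have hlt : ∀ x y, k (pos x) < k (pos y) ↔ rowPosition T (pos x) < rowPosition T (pos y) :=
    fun x y => (hk.lt_iff_lt (hpos x) (hpos y)).trans
      ((strictMonoOn_rowPosition T).lt_iff_lt (hpos x) (hpos y)).symm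
  have heq : ∀ x y, k (pos x) = k (pos y) ↔ rowPosition T (pos x) = rowPosition T (pos y) :=
    fun x y => by
      rw [eq_iff_le_not_lt, eq_iff_le_not_lt, ← not_lt, ← not_lt, hlt, hlt]
  have hmem : ∀ z, p z ∈ A := fun z => hp ▸ Set.mem_range_self z
  have key := ha.realize_iff (f k) (f (rowPosition T))
    (fun x y => by simp only [f, hS, hlt, heq]) Θ
    (fun z => Sum.elim (fun j => Sum.inr ((z.1, j), ())) (fun z => Sum.inl ⟨p z, hmem z⟩) z.2)
  rw [hΘ, hΘ] at key
  have hw : ∀ (k : ι ×ₗ ℕ → ℕ) (x : C) (i : T) (e : Fin 2),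
      (Sum.elim (fun _ : Unit => x) fun z : Fin n ⊕ Fin N =>
        Sum.elim (fun a : A => (a : C)) (fun q : ((T × Fin 2) × Fin n) × Unit => a (f k q.1))
          (Sum.elim (fun j => Sum.inr (((i, e), j), ())) (fun z => Sum.inl ⟨p z, hmem z⟩) z)) =
        Sum.elim (fun _ => x) (Sum.elim (a ∘ S (k (toLex ((i : ι), (e : ℕ))))) p) := by
    intro k x i e
    funext z
    rcases z with z | z | z <;> rfl
  simp only [hw] at key
  obtain ⟨x, hx⟩ := key.2 ⟨c, fun i => by simp [hχ, rowPosition]⟩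
  exact ⟨x, fun i hi => hx ⟨i, hi⟩⟩

theorem exists_indiscernible_end_segment {T : L.Theory} {μ : Cardinal.{w}}
    (hC : MonsterModel T C μ) (hdep : DependentTheory hC) {A : Set C} (hA : A.Finite)
    {a : SuccIndex L → C} (ha : Indiscernible L A (fun i (_ : Unit) => a i)) (c : C) :
    ∃ α : SuccIndex L, Indiscernible L (insert c A)
      (fun (i : {i : SuccIndex L // α < i}) (_ : Unit) => a i) := by
  classical
  by_contra! hcon
  have := hC.nonempty
  obtain ⟨N, p, hp⟩ : ∃ (N : ℕ) (p : Fin N → C), Set.range p = A := by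
    obtain ⟨N, p, -, hp⟩ := hA.fin_param
    exact ⟨N, p, hp⟩
  obtain ⟨n, χ, S, hS, hχ⟩ := exists_alternating_blocks hp hcon
  obtain ⟨κ, hκ, hrk⟩ := hdep
  let ι : Type w := κ.ord.ToType
  let row (i : ι) (m : ℕ) : L.Formula (Unit ⊕ (ι ×ₗ ℕ) × (Fin n ⊕ Fin N)) :=
    χ.relabel (Sum.map id fun z => (toLex (i, m), z))
  have hrow : ∀ (i : ι) (m : ℕ) (x : Unit → C) (b : ι ×ₗ ℕ → Fin n ⊕ Fin N → C),
      (row i m).Realize (Sum.elim x fun q => b q.1 q.2) ↔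
        χ.Realize (Sum.elim x (b (toLex (i, m)))) := by
    intro i m x b
    simp only [row, Formula.realize_relabel]
    refine iff_of_eq (congrArg _ (funext fun z => ?_))
    rcases z with z | z <;> rfl
  have hZ : #(Unit ⊕ (ι ×ₗ ℕ) × (Fin n ⊕ Fin N)) < μ := by
    have h0 := hC.aleph0_lt
    have h1 : #(ι ×ₗ ℕ) < μ := by
      change #(ι × ℕ) < μ
      rw [mk_prod]
      refine mul_lt_of_lt h0.le ?_ ?_
      · simpa [ι] using hκ
      · simpa using h0
    rw [mk_sum, mk_prod]
    refine add_lt_of_lt h0.le ?_ ?_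
    · simpa using (one_lt_aleph0.trans h0)
    · have h2 : Cardinal.lift.{w} #(Fin n ⊕ Fin N) < μ := (lift_lt_aleph0.2 mk_lt_aleph0).trans h0
      rw [Cardinal.lift_uzero, Cardinal.lift_uzero]
      exact mul_lt_of_lt h0.le h1 h2
  -- The tuple `p` is appended to every block, so that the extracted sequence need only be
  -- indiscernible over `∅`.
  obtain ⟨x, b, hb, hP⟩ := hC.saturated.exists_indiscernible (γ := Unit) (J := ι ×ₗ ℕ)
    (by rwa [Cardinal.lift_id, Cardinal.lift_id])
    (fun k => Sum.elim (a ∘ S k) p) ((fun i => row i 0 ⊓ (row i 1).not) '' Set.univ) (by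
      intro Q hQ hQf
      obtain ⟨T, -, hT, rfl⟩ := Set.exists_subset_image_finite_and.1 ⟨Q, hQ, hQf, rfl⟩
      refine ⟨(hT.toFinset ×ˢ Finset.range 2).image toLex, fun k hk => ?_⟩
      obtain ⟨x, hx⟩ := exists_realize_rows hp ha hS hχ hT.toFinset (k := k) (hk.mono (by
        rintro y ⟨h1, h2⟩
        refine Finset.mem_coe.2 (Finset.mem_image.2 ⟨ofLex y, ?_, rfl⟩)
        exact Finset.mem_product.2 ⟨h1, Finset.mem_range.2 h2⟩))
      refine ⟨fun _ => x, ?_⟩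
      rintro _ ⟨i, hi, rfl⟩
      rw [Formula.realize_inf, Formula.realize_not,
        hrow i 0 _ (fun q => Sum.elim (a ∘ S (k q)) p), hrow i 1 _ (fun q => Sum.elim (a ∘ S (k q)) p)]
      exact hx i (hT.mem_toFinset.2 hi))
  let g : ULift.{w} ℕ ↪o ℕ := OrderEmbedding.ofStrictMono ULift.down fun _ _ h => h
  obtain ⟨i, hi⟩ := hrk (fun _ => x ()) (by
      rintro _ rfl
      simp [Formula.realize_equal]) ι (by simp [ι]) (fun _ => ULift.{w} ℕ)
    (fun _ => ULift.{w} (Fin n ⊕ Fin N)) _ (mutuallyIndiscernible_of_lex hb g ULift.down)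
  -- A formula about a single member of the row, with parameter `x`, already separates columns 0 and
  -- 1.
  obtain ⟨φ, hφ⟩ := exists_constants_of_formula (C := C)
    (A := ∅ ∪ Set.range fun _ : Fin 1 => x ()) (β := Fin 1 × ULift.{w} (Fin n ⊕ Fin N)) χ
    (Sum.elim (fun _ => Sum.inl ⟨x (), Or.inr ⟨0, rfl⟩⟩) fun z => Sum.inr (0, ⟨z⟩))
  have hφ' : ∀ s : Fin 1 ↪o ULift.{w} ℕ, φ.Realize (fun z => b (toLex (i, g (s z.1))) z.2.down) ↔
      χ.Realize (Sum.elim x (b (toLex (i, (s 0).down)))) := by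
    intro s
    rw [hφ]
    refine iff_of_eq (congrArg _ (funext fun z => ?_))
    rcases z with z | z <;> rfl
  have hPi := hP _ ⟨i, trivial, rfl⟩
  rw [Formula.realize_inf, Formula.realize_not, hrow, hrow] at hPi
  have emb : ∀ m : ℕ, ∃ s : Fin 1 ↪o ULift.{w} ℕ, (s 0).down = m := fun m =>
    ⟨OrderEmbedding.ofStrictMono (fun _ => ⟨m⟩) (Subsingleton.strictMono _), rfl⟩
  obtain ⟨s, hs⟩ := emb 0
  obtain ⟨t, ht⟩ := emb 1
  have h := hi 1 φ s t
  rw [hφ', hφ', hs, ht] at h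
  exact hPi.2 (h.1 hPi.1)

end Forward

/-! ### Indiscernible end segments imply dependence -/

section Backward

variable {L : FirstOrder.Language.{u, v}} {C : Type w} [L.Structure C]

/-- Removing an initial segment of size at most `|T|` leaves a well-order of cardinality `|T|⁺`
inside `|T|⁺`, so its order type is again `|T|⁺`. This lets the hypothesis be applied repeatedly. -/
theorem nonempty_orderIso_end_segment (α : SuccIndex L) :
    Nonempty (SuccIndex L ≃o {i : SuccIndex L // α < i}) := by
  have h0 : ℵ₀ ≤ theoryCard L := le_max_left _ _
  have hcard : Order.succ (theoryCard L) ≤ #{i : SuccIndex L // α < i} := by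
    by_contra! h
    have h1 : #{i : SuccIndex L // α < i} ≤ theoryCard L := Order.lt_succ_iff.1 h
    have h2 : #(Set.Iic α ∪ Set.Ioi α : Set (SuccIndex L)) ≤ theoryCard L :=
      (mk_union_le _ _).trans (add_le_of_le h0 (mk_Iic_succIndex_le L α) h1)
    rw [Set.Iic_union_Ioi, mk_univ, mk_ord_toType] at h2
    exact (Order.lt_succ (theoryCard L)).not_ge h2
  have h1 : Ordinal.type (α := SuccIndex L) (· < ·) ≤
      Ordinal.type (α := {i : SuccIndex L // α < i}) (· < ·) := by
    rw [Ordinal.type_toType, ord_le]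
    exact hcard
  have h2 : Ordinal.type (α := {i : SuccIndex L // α < i}) (· < ·) ≤
      Ordinal.type (α := SuccIndex L) (· < ·) :=
    RelEmbedding.ordinal_type_le (OrderEmbedding.subtype _).ltEmbedding
  obtain ⟨e⟩ := Ordinal.type_eq.1 (h1.antisymm h2)
  exact ⟨OrderIso.ofRelIsoLT e⟩

theorem Indiscernible.comp {A : Set C} {J J' α : Type*} [LinearOrder J] [LinearOrder J']
    {I : J → α → C} (hI : Indiscernible L A I) (f : J' ↪o J) :
    Indiscernible L A (fun j => I (f j)) :=
  fun n φ s t => hI n φ (s.trans f) (t.trans f)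

/-- Add the elements of `B` one at a time; after each step the end segment is reindexed by `|T|⁺`,
and those already added serve as the finite set `A`. -/
theorem exists_indiscernible_end_segment_of_finite
    (h : ∀ (A : Set C), A.Finite →
        ∀ a : SuccIndex L → C, Indiscernible L A (fun i (_ : Unit) => a i) →
          ∀ c : C, ∃ α : SuccIndex L, Indiscernible L (insert c A)
              (fun (i : {i : SuccIndex L // α < i}) (_ : Unit) => a i))
    {a : SuccIndex L → C} (ha : Indiscernible L ∅ (fun i (_ : Unit) => a i))
    {B : Set C} (hB : B.Finite) :
    ∃ α : SuccIndex L, Indiscernible L B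
      (fun (i : {i : SuccIndex L // α < i}) (_ : Unit) => a i) := by
  induction B, hB using Set.Finite.induction_on with
  | empty => exact ⟨Classical.arbitrary _, ha.comp (OrderEmbedding.subtype (Classical.arbitrary (SuccIndex L) < ·))⟩
  | @insert c B _ hB ih =>
    obtain ⟨α, hα⟩ := ih
    obtain ⟨e⟩ := nonempty_orderIso_end_segment α
    obtain ⟨α', hα'⟩ := h B hB (fun i => a (e i)) (hα.comp e.toOrderEmbedding) c
    have hlt : ∀ i : {i : SuccIndex L // (e α' : SuccIndex L) < i}, α < (i : SuccIndex L) :=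
      fun i => (e α').2.trans i.2
    let f : {i : SuccIndex L // (e α' : SuccIndex L) < i} ↪o {i : SuccIndex L // α' < i} :=
      OrderEmbedding.ofStrictMono
        (fun i => ⟨e.symm ⟨i, hlt i⟩, by rw [e.lt_symm_apply]; exact i.2⟩)
        (fun i j hij => e.symm.strictMono hij)
    refine ⟨e α', ?_⟩
    have hf : ∀ i, (e (f i) : SuccIndex L) = i := fun i =>
      congrArg Subtype.val (e.apply_symm_apply ⟨(i : SuccIndex L), hlt i⟩)
    have := hα'.comp f
    simpa only [hf] using this

/-- Only the variables in `β` are renamed to a finite set; those in `δ` keep their role, here that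
of the element over which indiscernibility fails. -/
theorem exists_finite_support_right {δ β : Type*} (ψ : L.Formula (δ ⊕ β)) :
    ∃ (m : ℕ) (χ : L.Formula (δ ⊕ Fin m)) (f : Fin m → β), ∀ (d : δ → C) (v : β → C),
      ψ.Realize (Sum.elim d v) ↔ χ.Realize (Sum.elim d (v ∘ f)) := by
  classical
  let G := ψ.freeVarFinset.preimage Sum.inr Sum.inr_injective.injOn
  let e := G.equivFin
  have hG : ∀ x : ψ.freeVarFinset, ∃ z : δ ⊕ Fin G.card,
      (x : δ ⊕ β) = Sum.map id (fun k => (e.symm k : β)) z := by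
    rintro ⟨x | x, hx⟩
    · exact ⟨Sum.inl x, rfl⟩
    · exact ⟨Sum.inr (e ⟨x, Finset.mem_preimage.2 hx⟩), by simp⟩
  choose g hg using hG
  refine ⟨_, BoundedFormula.restrictFreeVar ψ g, fun k => (e.symm k : β), fun d v => ?_⟩
  refine (BoundedFormula.realize_restrictFreeVar (φ := ψ) (f := g)
    (v' := Sum.elim d v) (fun x => ?_)).symm
  rw [hg x]
  rcases g x with z | z <;> rfl

/-- The map `g` absorbs the possibly infinite tuple length, so `χ` ranges over a set of at most
`|T|` formulas that does not depend on the sequence. -/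
theorem exists_formula_of_not_indiscernible_singleton {c : Fin 1 → C} {J α : Type*} [LinearOrder J]
    {I : J → α → C} (h : ¬ Indiscernible L (∅ ∪ Set.range c) I) :
    ∃ (χ : Σ m, L.Formula (Unit ⊕ Fin m)) (n : ℕ) (g : Fin χ.1 → Fin n × α) (s t : Fin n ↪o J),
      χ.2.Realize (Sum.elim (fun _ => c 0) (fun z => I (s (g z).1) (g z).2)) ∧
      ¬ χ.2.Realize (Sum.elim (fun _ => c 0) (fun z => I (t (g z).1) (g z).2)) := by
  simp only [Indiscernible, not_forall] at h
  obtain ⟨n, φ, s, t, h⟩ := h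
  obtain ⟨ψ, hψ⟩ := exists_formula_of_constants φ
  obtain ⟨m, χ, g, hχ⟩ := exists_finite_support_right (C := C)
    (ψ.relabel (Sum.map (fun _ => ()) id) : L.Formula (Unit ⊕ Fin n × α))
  have key : ∀ s : Fin n ↪o J, φ.Realize (fun k => I (s k.1) k.2) ↔
      χ.Realize (Sum.elim (fun _ => c 0) (fun z => I (s (g z).1) (g z).2)) := by
    intro s
    rw [hψ]
    refine Iff.trans (iff_of_eq ?_) (hχ (fun _ => c 0) (fun k => I (s k.1) k.2))
    rw [Formula.realize_relabel]
    refine congrArg _ (funext fun z => ?_)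
    rcases z with ⟨x, hx⟩ | z
    · obtain ⟨i, rfl⟩ := hx.resolve_left id
      simp [Subsingleton.elim i 0]
    · rfl
  rw [key, key] at h
  by_cases hs : χ.Realize (Sum.elim (fun _ => c 0) (fun z => I (s (g z).1) (g z).2))
  · exact ⟨⟨m, χ⟩, n, g, s, t, hs, fun ht => h (iff_of_true hs ht)⟩
  · by_cases ht : χ.Realize (Sum.elim (fun _ => c 0) (fun z => I (t (g z).1) (g z).2))
    · exact ⟨⟨m, χ⟩, n, g, t, s, ht, hs⟩
    · exact (h (iff_of_false hs ht)).elim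

/-- Entries from the other sequences are legitimate parameters for the indiscernibility of `I (i
k)`, so one block may be moved while the rest stay fixed. -/
theorem realize_update_iff_of_mutuallyIndiscernible {ι : Type*} {J : ι → Type*}
    [∀ i, LinearOrder (J i)] {α : ι → Type*} {I : ∀ i, J i → α i → C}
    (hI : MutuallyIndiscernible L ∅ I) {m : ℕ} {K : Type*} [DecidableEq K] {i : K → ι}
    (hi : Function.Injective i) (k : K) (ψ : L.Formula (K × Fin m)) (w : K → Fin m → C)
    (hw : ∀ k' ≠ k, ∀ z, w k' z ∈ seqSet (I (i k'))) {n : ℕ} (g : Fin m → Fin n × α (i k))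
    (s t : Fin n ↪o J (i k)) :
    ψ.Realize (fun z => Function.update w k (fun z => I (i k) (s (g z).1) (g z).2) z.1 z.2) ↔
      ψ.Realize (fun z => Function.update w k (fun z => I (i k) (t (g z).1) (g z).2) z.1 z.2) := by
  have hmem : ∀ k' ≠ k, ∀ z, w k' z ∈ ∅ ∪ ⋃ j ∈ {j | j ≠ i k}, seqSet (I j) := fun k' hk z =>
    Or.inr (Set.mem_biUnion (x := i k') (hi.ne hk) (hw k' hk z))
  obtain ⟨φ, hφ⟩ := exists_constants_of_formula (C := C) ψ
    (fun z => if h : z.1 = k then Sum.inr (g z.2) else Sum.inl ⟨w z.1 z.2, hmem _ h _⟩)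
  have key : ∀ s : Fin n ↪o J (i k), φ.Realize (fun p => I (i k) (s p.1) p.2) ↔
      ψ.Realize (fun z =>
        Function.update w k (fun z => I (i k) (s (g z).1) (g z).2) z.1 z.2) := by
    intro s
    rw [hφ]
    refine iff_of_eq (congrArg _ (funext fun z => ?_))
    by_cases h : z.1 = k
    · simp [h]
    · simp [h]
  rw [← key, ← key]
  exact hI (i k) n φ s t

/-- A single formula `χ(x, y)` has the independence property, with `x` a single variable, if
`|T|⁺` many mutually indiscernible sequences are all not indiscernible over one element. -/
theorem exists_independent_of_not_dpRankLT {κ : Cardinal.{w}}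
    (hκ : Cardinal.lift.{max u v} κ = Cardinal.lift.{w} (Order.succ (theoryCard L)))
    (h : ¬ DpRankLT L (trivialType L C) κ) :
    ∃ (m : ℕ) (χ : L.Formula (Unit ⊕ Fin m)) (b : ℕ → Fin m → C),
      ∀ X T : Finset ℕ, ∃ x : C, ∀ k ∈ X, (χ.Realize (Sum.elim (fun _ => x) (b k)) ↔ k ∈ T) := by
  classical
  simp only [DpRankLT, not_forall, not_exists] at h
  obtain ⟨c, -, ι, hι, J, _, _, α, I, hI, hn⟩ := h
  choose χ n g s t hs ht using fun i => exists_formula_of_not_indiscernible_singleton (hn i)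
  have hcard : Cardinal.lift.{w} #(SuccIndex L) = Cardinal.lift.{max u v} #ι := by
    rw [hι, hκ, mk_ord_toType]
  obtain ⟨e⟩ := Cardinal.lift_mk_eq'.1 hcard
  obtain ⟨⟨m, χ₀⟩, hχ₀⟩ := exists_cofinal_fiber L
    (mk_sigma_formula_le_theoryCard L fun m => Unit ⊕ Fin m) fun j => χ (e j)
  choose next hlt hnext using hχ₀
  let j (k : ℕ) : SuccIndex L := next^[k + 1] (Classical.arbitrary _)
  have hjs : ∀ k, j k = next (next^[k] (Classical.arbitrary _)) := fun k =>
    Function.iterate_succ_apply' _ _ _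
  have hj : StrictMono j := strictMono_nat_of_lt_succ fun k => by
    rw [hjs (k + 1)]
    exact hlt _
  have hχj : ∀ k, χ (e (j k)) = ⟨m, χ₀⟩ := fun k => by rw [hjs, hnext]
  have hinj : Function.Injective fun k => e (j k) := e.injective.comp hj.injective
  have hblock : ∀ k, ∃ (n : ℕ) (g : Fin m → Fin n × α (e (j k))) (s t : Fin n ↪o J (e (j k))),
      χ₀.Realize (Sum.elim (fun _ => c 0) (fun z => I (e (j k)) (s (g z).1) (g z).2)) ∧
      ¬ χ₀.Realize (Sum.elim (fun _ => c 0) (fun z => I (e (j k)) (t (g z).1) (g z).2)) := by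
    intro k
    have h1 := hs (e (j k))
    have h2 := ht (e (j k))
    -- The type of `g` depends on the formula at `e (j k)`, so it is generalized before that formula
    -- is replaced by the common one.
    generalize g (e (j k)) = g' at h1 h2
    revert g'
    rw [hχj k]
    exact fun g' h1 h2 => ⟨_, g', _, _, h1, h2⟩
  choose n g s t hs ht using hblock
  let b₁ (k : ℕ) (z : Fin m) : C := I (e (j k)) (s k (g k z).1) (g k z).2
  let b₀ (k : ℕ) (z : Fin m) : C := I (e (j k)) (t k (g k z).1) (g k z).2
  -- The element `c` realizes the pattern `T` on the mixed family `w T`. Changing one block at a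
  -- time gives `w T` the same type as `b₀`, so `b₀` admits every finite pattern.
  let w (T : Finset ℕ) (k : ℕ) : Fin m → C := if k ∈ T then b₁ k else b₀ k
  have hwmem : ∀ T k z, w T k z ∈ seqSet (I (e (j k))) := by
    intro T k z
    by_cases hk : k ∈ T
    · exact ⟨s k (g k z).1, (g k z).2, by simp [w, hk, b₁]⟩
    · exact ⟨t k (g k z).1, (g k z).2, by simp [w, hk, b₀]⟩
  have transfer : ∀ (ψ : L.Formula (ℕ × Fin m)) (T : Finset ℕ),
      ψ.Realize (fun z => w T z.1 z.2) ↔ ψ.Realize (fun z => b₀ z.1 z.2) := by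
    intro ψ T
    induction T using Finset.induction_on with
    | empty => simp [w]
    | @insert k T hk ih =>
      rw [← ih]
      have h1 : w (insert k T) = Function.update (w T) k (b₁ k) := by
        funext k'
        by_cases h : k' = k
        · subst h
          simp [w]
        · simp [w, h]
      have h0 : w T = Function.update (w T) k (b₀ k) := by
        funext k'
        by_cases h : k' = k
        · subst h
          simp [w, hk]
        · simp [h]
      rw [h1]
      conv_rhs => rw [h0]
      exact realize_update_iff_of_mutuallyIndiscernible hI hinj k ψ (w T)
        (fun k' _ z => hwmem T k' z) (g k) (s k) (t k)
  refine ⟨m, χ₀, b₀, fun X T => ?_⟩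
  let at_ (k : ℕ) : L.Formula ((ℕ × Fin m) ⊕ Unit) :=
    χ₀.relabel (Sum.elim (fun _ => Sum.inr ()) fun z => Sum.inl (k, z))
  let Θ : L.Formula (ℕ × Fin m) :=
    (Formula.iInf fun k : X => if (k : ℕ) ∈ T then at_ k else (at_ k).not).iExs Unit
  have hΘ : ∀ v : ℕ → Fin m → C, Θ.Realize (fun z => v z.1 z.2) ↔
      ∃ x : C, ∀ k ∈ X, (χ₀.Realize (Sum.elim (fun _ => x) (v k)) ↔ k ∈ T) := by
    intro v
    have hat : ∀ (k : ℕ) (x : Unit → C), (at_ k).Realize (Sum.elim (fun z => v z.1 z.2) x) ↔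
        χ₀.Realize (Sum.elim (fun _ => x ()) (v k)) := by
      intro k x
      rw [Formula.realize_relabel]
      refine iff_of_eq (congrArg _ (funext fun z => ?_))
      rcases z with z | z <;> rfl
    have hif : ∀ (k : ℕ) (x : Unit → C), (if k ∈ T then at_ k else (at_ k).not).Realize
        (Sum.elim (fun z => v z.1 z.2) x) ↔
        (χ₀.Realize (Sum.elim (fun _ => x ()) (v k)) ↔ k ∈ T) := by
      intro k x
      by_cases hk : k ∈ T
      · simp [hk, hat]
      · simp [hk, hat]
    simp only [Θ, Formula.realize_iExs, Formula.realize_iInf, hif, Subtype.forall]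
    exact ⟨fun ⟨x, hx⟩ => ⟨x (), hx⟩, fun ⟨x, hx⟩ => ⟨fun _ => x, hx⟩⟩
  refine (hΘ b₀).1 ((transfer Θ T).1 ((hΘ (w T)).2 ⟨c 0, fun k _ => ?_⟩))
  by_cases hk : k ∈ T
  · simpa [w, hk] using hs k
  · simpa [w, hk] using ht k

/-- The dual form of the independence property, with infinitely many elements. -/
theorem IsSaturated.exists_dual_independent {μ : Cardinal.{w}} (hC : IsSaturated L C μ)
    [Nonempty C] (hμ : ℵ₀ < μ) {m : ℕ} {χ : L.Formula (Unit ⊕ Fin m)} {b : ℕ → Fin m → C}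
    (hb : ∀ X T : Finset ℕ, ∃ x : C, ∀ k ∈ X,
      (χ.Realize (Sum.elim (fun _ => x) (b k)) ↔ k ∈ T)) :
    ∃ x : ℕ → C, ∀ S : Finset ℕ, ∃ y : Fin m → C, ∀ k,
      (χ.Realize (Sum.elim (fun _ => x k) y) ↔ k ∈ S) := by
  classical
  let at_ (k : ℕ) (S : Finset ℕ) : L.Formula (ℕ ⊕ Finset ℕ × Fin m) :=
    χ.relabel (Sum.map (fun _ => k) fun z => (S, z))
  have hat : ∀ (k : ℕ) (S : Finset ℕ) (v : ℕ ⊕ Finset ℕ × Fin m → C), (at_ k S).Realize v ↔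
      χ.Realize (Sum.elim (fun _ => v (Sum.inl k)) fun z => v (Sum.inr (S, z))) := by
    intro k S v
    rw [Formula.realize_relabel]
    refine iff_of_eq (congrArg _ (funext fun z => ?_))
    rcases z with z | z <;> rfl
  let D (r : ℕ × Finset ℕ) : L.Formula (ℕ ⊕ Finset ℕ × Fin m) :=
    if r.1 ∈ r.2 then at_ r.1 r.2 else (at_ r.1 r.2).not
  have hD : ∀ (r : ℕ × Finset ℕ) (v : ℕ ⊕ Finset ℕ × Fin m → C), (D r).Realize v ↔ (χ.Realize (Sum.elim (fun _ => v (Sum.inl r.1))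
      fun z => v (Sum.inr (r.2, z))) ↔ r.1 ∈ r.2) := by
    intro r v
    by_cases hr : r.1 ∈ r.2
    · simp [D, hr, hat]
    · simp [D, hr, hat]
  have hZ : Cardinal.lift.{w} #(ℕ ⊕ Finset ℕ × Fin m) < Cardinal.lift.{0} μ := by
    rw [Cardinal.lift_uzero]
    exact (lift_le_aleph0.2 mk_le_aleph0).trans_lt hμ
  obtain ⟨v, hv⟩ := hC.realizes hZ (D '' Set.univ) (by
    intro Q hQ hQf
    obtain ⟨R, -, hR, rfl⟩ := Set.exists_subset_image_finite_and.1 ⟨Q, hQ, hQf, rfl⟩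
    -- The tuple `y_S` is taken to be `b` at the code of `S`; then `x_k` must satisfy `χ` exactly at
    -- the codes of those `S`, among the finitely many in play, that contain `k`.
    let X : Finset ℕ := hR.toFinset.image fun r => Encodable.encode r.2
    choose x hx using fun k : ℕ => hb X
      ((hR.toFinset.filter fun r => k ∈ r.2).image fun r => Encodable.encode r.2)
    refine ⟨Sum.elim x fun q => b (Encodable.encode q.1) q.2, ?_⟩
    rintro _ ⟨r, hr, rfl⟩
    rw [hD]
    refine (hx r.1 (Encodable.encode r.2)
      (Finset.mem_image_of_mem _ (hR.mem_toFinset.2 hr))).trans ?_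
    simp only [Finset.mem_image, Finset.mem_filter, Set.Finite.mem_toFinset,
      Encodable.encode_inj]
    exact ⟨fun ⟨r', h1, h2⟩ => h2 ▸ h1.2, fun h => ⟨r, ⟨hr, h⟩, rfl⟩⟩)
  refine ⟨fun k => v (Sum.inl k), fun S => ⟨fun z => v (Sum.inr (S, z)), fun k => ?_⟩⟩
  exact (hD (k, S) v).1 (hv _ ⟨(k, S), trivial, rfl⟩)

theorem dependentTheory_of_end_segments {T : L.Theory} {μ : Cardinal.{w}}
    (hC : MonsterModel T C μ)
    (h : ∀ (A : Set C), A.Finite →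
        ∀ a : SuccIndex L → C, Indiscernible L A (fun i (_ : Unit) => a i) →
          ∀ c : C, ∃ α : SuccIndex L, Indiscernible L (insert c A)
              (fun (i : {i : SuccIndex L // α < i}) (_ : Unit) => a i)) :
    DependentTheory hC := by
  classical
  have := hC.nonempty
  -- Since `|T|⁺` lies below `μ` it has a copy in the universe of `μ`, and this small cardinal is
  -- the one tested against dependence.
  obtain ⟨κ, hκ⟩ := Cardinal.mem_range_lift_of_le hC.large.le
  have hκμ : κ < μ := by
    rw [← Cardinal.lift_lt.{w, max u v}, hκ]
    exact hC.large
  by_contra hnd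
  obtain ⟨m, χ, b, hb⟩ := exists_independent_of_not_dpRankLT hκ fun hrk => hnd ⟨κ, hκμ, hrk⟩
  obtain ⟨x, hx⟩ := hC.saturated.exists_dual_independent hC.aleph0_lt hb
  obtain ⟨S, hS, hS'⟩ := exists_cofinal_compl_cofinal L
  let at_ (j : SuccIndex L) : L.Formula (Fin m ⊕ SuccIndex L × Unit) :=
    χ.relabel (Sum.elim (fun _ => Sum.inr (j, ())) Sum.inl)
  have hat : ∀ (j : SuccIndex L) (y : Fin m → C) (a : SuccIndex L → Unit → C),
      (at_ j).Realize (Sum.elim y fun q => a q.1 q.2) ↔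
        χ.Realize (Sum.elim (fun _ => a j ()) y) := by
    intro j y a
    rw [Formula.realize_relabel]
    refine iff_of_eq (congrArg _ (funext fun z => ?_))
    rcases z with z | z <;> rfl
  let D (j : SuccIndex L) : L.Formula (Fin m ⊕ SuccIndex L × Unit) :=
    if j ∈ S then at_ j else (at_ j).not
  have hD : ∀ (j : SuccIndex L) (y : Fin m → C) (a : SuccIndex L → Unit → C),
      (D j).Realize (Sum.elim y fun q => a q.1 q.2) ↔
        (χ.Realize (Sum.elim (fun _ => a j ()) y) ↔ j ∈ S) := by
    intro j y a
    by_cases hj : j ∈ S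
    · simp [D, hj, hat]
    · simp [D, hj, hat]
  have hZ : Cardinal.lift.{w} #(Fin m ⊕ SuccIndex L × Unit) < Cardinal.lift.{max u v} μ := by
    refine lt_of_le_of_lt (Cardinal.lift_le.2 ?_) hC.large
    have h0 : ℵ₀ ≤ Order.succ (theoryCard L) := (le_max_left _ _).trans (Order.le_succ _)
    rw [mk_sum, mk_prod]
    refine add_le_of_le h0 ((lift_lt_aleph0.2 mk_lt_aleph0).le.trans h0) ?_
    simp
  obtain ⟨y, a, ha, hP⟩ := hC.saturated.exists_indiscernible hZ (fun k _ => x k)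
    (D '' Set.univ) (by
      intro Q hQ hQf
      obtain ⟨F, -, hF, rfl⟩ := Set.exists_subset_image_finite_and.1 ⟨Q, hQ, hQf, rfl⟩
      refine ⟨hF.toFinset, fun k hk => ?_⟩
      -- The finite set prescribed to `y` is the `k`-image of the relevant part of `S`; injectivity
      -- of `k` there recovers membership in `S`.
      obtain ⟨y, hy⟩ := hx ((hF.toFinset.filter (· ∈ S)).image k)
      refine ⟨y, ?_⟩
      rintro _ ⟨j, hj, rfl⟩
      refine (hD j y fun q _ => x (k q)).2 ((hy (k j)).trans ?_)
      simp only [Finset.mem_image, Finset.mem_filter]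
      constructor
      · rintro ⟨j', ⟨h1, h2⟩, h3⟩
        rwa [← hk.injOn h1 (hF.mem_toFinset.2 hj) h3]
      · exact fun h => ⟨j, ⟨hF.mem_toFinset.2 hj, h⟩, rfl⟩)
  obtain ⟨α, hα⟩ := exists_indiscernible_end_segment_of_finite h (a := fun i => a i ()) ha
    (Set.finite_range y)
  obtain ⟨β, hβ, hαβ⟩ := hS α
  obtain ⟨β', hβ', hαβ'⟩ := hS' α
  have key := hα.realize_iff (X := Unit) (fun _ => ⟨β, hαβ⟩) (fun _ => ⟨β', hαβ'⟩)
    (fun _ _ => by simp) χ (Sum.elim (fun _ => Sum.inr ((), ())) fun z => Sum.inl ⟨y z, z, rfl⟩)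
  have hv : ∀ i : {i : SuccIndex L // α < i}, (fun z : Unit ⊕ Fin m =>
      Sum.elim (fun a : Set.range y => (a : C)) (fun _ : Unit × Unit => a i ())
        (Sum.elim (fun _ => Sum.inr ((), ())) (fun z => Sum.inl ⟨y z, z, rfl⟩) z)) =
      Sum.elim (fun _ => a i ()) y := by
    intro i
    funext z
    rcases z with z | z <;> rfl
  rw [hv ⟨β, hαβ⟩, hv ⟨β', hαβ'⟩] at key
  have h1 := (hD β y a).1 (hP _ ⟨β, trivial, rfl⟩)
  have h2 := (hD β' y a).1 (hP _ ⟨β', trivial, rfl⟩)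
  exact hβ' (h2.1 (key.1 (h1.2 hβ)))

end Backward

end DpRank

theorem mainTheorem4 {L : FirstOrder.Language.{u, v}} (T : L.Theory) (hT : T.IsComplete)
    {C : Type w} [L.Structure C] {μ : Cardinal.{w}} (hC : DpRank.MonsterModel T C μ) :
    DpRank.DependentTheory hC ↔
      ∀ (A : Set C), A.Finite →
        ∀ a : DpRank.SuccIndex L → C, DpRank.Indiscernible L A (fun i (_ : Unit) => a i) →
          ∀ c : C, ∃ α : DpRank.SuccIndex L,
            DpRank.Indiscernible L (insert c A)
              (fun (i : {i : DpRank.SuccIndex L // α < i}) (_ : Unit) => a i) :=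
  ⟨fun h _ hA _ ha c => DpRank.exists_indiscernible_end_segment hC h hA ha c,
    DpRank.dependentTheory_of_end_segments hC⟩
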